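/- Let $$A=\begin{pmatrix}1&6\\0&1\end{pmatrix},\qquad B=\begin{pmatrix}1&0\\ \tfrac32&1\end{pmatrix},$$ and let $\Gamma\subset \mathrm{PSL}_2(\mathbb R)$ be the group generated by the classes of $A$ and $B$. It acts on the hyperbolic plane $\mathbb H^2$ and, projectively, on its circle at infinity $\mathbb{RP}^1$, the set of lines through the origin of $\mathbb R^2$ (the line $[x:y]$ corresponding to the boundary point $x/y\in\mathbb R\cup\{\infty\}$ of the upper half-plane, and having slope $y/x$). Let $z_0 \in \mathbb H^2$ be any base point, let $\Lambda_\Gamma\subset\mathbb{RP}^1$ be the limit set of $\Gamma$, that is, the set of accumulation points of the orbit $\Gamma\cdot z_0$ on the circle at infinity, and let $\Omega_\Gamma=\mathbb{RP}^1\setminus\Lambda_\Gamma$ be the discontinuity set. Then the quotient space $\Omega_\Gamma/\Gamma$ is homeomorphic to a circle. Moreover, the set $$I=\{[\cos\theta:\sin\theta] \;:\; \arctan(1/4)\le\theta\le\arctan(1)\}$$ of lines of slope between $1/4$ and $1$ is a fundamental domain for the action of $\Gamma$ on $\Omega_\Gamma$: it is the closure in $\Omega_\Gamma$ of its interior, the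 union of its translates by $\Gamma$ is $\Omega_\Gamma$, and the translates of its interior by distinct elements of $\Gamma$ are disjoint. The element $AB^{-1}$ is hyperbolic and maps one endpoint of $I$ to the other: $AB^{-1}[1:1]=[4:1]$. -/

import Mathlib

open scoped MatrixGroups UpperHalfPlane Pointwise

noncomputable section

namespace DiscoGroup

/-- `PSL(2, ℝ)` acts on the circle at infinity `ℝℙ¹`. The point `[x : y]` of `ℝℙ¹` is read in the
affine chart `x / y` as a point of `OnePoint ℝ`, with `[1 : 0] = ∞`, so a class of matrices
`(a, b; c, d)` acts by the homography `t ↦ (a t + b) / (c t + d)`. -/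
instance boundaryAction : MulAction PSL(2, ℝ) (OnePoint ℝ) :=
  (OnePoint.equivProjectivization ℝ).mulAction PSL(2, ℝ)

/-- `PSL(2, ℝ)` acts on the hyperbolic plane by the same homographies. -/
instance hyperbolicPlaneAction : MulAction PSL(2, ℝ) ℍ :=
  MulAction.compHom ℍ (Matrix.ProjectiveSpecialLinearGroup.toPGL (n := Fin 2) (R := ℝ))

/-- The point of the Riemann sphere given by a point of the hyperbolic plane. -/
def planePoint (z : ℍ) : OnePoint ℂ := ((z : ℂ) : OnePoint ℂ)

/-- The point of the Riemann sphere given by a point of the circle at infinity. The images of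
`planePoint` and `boundaryPoint` together form the closed disk that compactifies `ℍ`. -/
def boundaryPoint (x : OnePoint ℝ) : OnePoint ℂ := OnePoint.map Complex.ofReal x

/-- The limit set of `Φ`: the points of the circle at infinity that are accumulation points of the
orbit of the base point `z₀` of the hyperbolic plane. -/
def limitSet (Φ : Subgroup PSL(2, ℝ)) (z₀ : ℍ) : Set (OnePoint ℝ) :=
  {x | AccPt (boundaryPoint x) (Filter.principal (planePoint '' MulAction.orbit Φ z₀))}

/-- The discontinuity set of `Φ`. -/
def discontinuitySet (Φ : Subgroup PSL(2, ℝ)) (z₀ : ℍ) : Set (OnePoint ℝ) :=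
  (limitSet Φ z₀)ᶜ

/-- The quotient of a subset `S` of a `G`-space, with its subspace topology, by the relation of
lying in the same `G`-orbit. It carries the quotient topology. -/
abbrev orbitQuotient (G : Type*) {X : Type*} [Group G] [MulAction G X] (S : Set X) : Type _ :=
  Quotient ((MulAction.orbitRel G X).comap (Subtype.val : S → X))

/-- `F` is a fundamental domain for the action of `G` on the open invariant subset `Ω` of `X`:
a closed region of `Ω` (the closure in `Ω` of its own interior), whose translates cover `Ω`
and have pairwise disjoint interiors. -/
structure IsFundamentalRegion (G : Type*) {X : Type*} [Group G] [MulAction G X]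
    [TopologicalSpace X] (Ω F : Set X) : Prop where
  closure_interior : closure (interior F) ∩ Ω = F
  iUnion_smul : ⋃ g : G, g • F = Ω
  disjoint_interior : ∀ g : G, g ≠ 1 → Disjoint (interior F) (g • interior F)

def A : SL(2, ℝ) := ⟨!![1, 6; 0, 1], by simp [Matrix.det_fin_two]⟩

def B : SL(2, ℝ) := ⟨!![1, 0; 3 / 2, 1], by simp [Matrix.det_fin_two]⟩

/-- The subgroup of `PSL(2, ℝ)` generated by the classes of `A` and `B`. -/
def Γ : Subgroup PSL(2, ℝ) := Subgroup.closure {(A : PSL(2, ℝ)), (B : PSL(2, ℝ))}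

/-- The direction `[cos θ : sin θ]`, that is, the line of slope `tan θ`. -/
def direction (θ : ℝ) : OnePoint ℝ :=
  (OnePoint.equivProjectivization ℝ).symm
    (Projectivization.mk ℝ ![Real.cos θ, Real.sin θ] (fun h => by
      have h0 : Real.cos θ = 0 := congrFun h 0
      have h1 : Real.sin θ = 0 := congrFun h 1
      simpa [h0, h1] using Real.sin_sq_add_cos_sq θ))

/-- The directions whose angle lies in `[arctan (1/4), arctan 1]`. -/
def fundamentalInterval : Set (OnePoint ℝ) :=
  direction '' Set.Icc (Real.arctan (1 / 4)) (Real.arctan 1)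

end DiscoGroup

end

/-! In the coordinate `t = x / y`, `A` is `t ↦ t + 6` and `B` is the shift of `1 / t` by `3 / 2`.
The interval `[-2, 4)` is a domain for `⟨A⟩`, and the complement of `[-2, 1)` is one for `⟨B⟩`. The
complements of these domains are disjoint, so ping-pong shows that distinct translates of their
intersection `[1, 4)` are disjoint (`eq_one_of_smul_coe_eq_coe`).

The discontinuity set is exactly the union of these translates (`mem_discontinuitySet_iff`).
Ping-pong in `ℍ` gives a domain that meets each orbit at most once, and three translates of it cover
a strip around `[1, 4)`. Orbits are therefore finite there, and `[1, 4)` contains no limit point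
(`coe_notMem_limitSet`). Conversely, `0` and `∞` are parabolic limit points. Any other point outside
the translates can be moved into `[-2, 1)` and unfolds there as an infinite product of maps `B ^ m *
A ^ k` with nonzero exponents. Each of these contracts a strip by `1 / 25`, so orbit points converge
to it (`mem_limitSet_of_forall_smul_ne`).

For the quotient, `A * B⁻¹` fixes `3 ± √5` and acts on the interval between them as a translation of
`ℝ` with `[1, 4)` as one period. By ping-pong, points of that interval are `Γ`-equivalent only
through powers of `A * B⁻¹`. Hence the line maps openly onto the quotient with the fibres of `ℝ →
AddCircle axisPeriod`. -/

namespace OnePoint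

open Filter Topology

/-! ### Homogeneous coordinates and continuity of homographies. -/

section Field

variable {K : Type*} [Field K] [DecidableEq K]

/-- The point `x / y` of the projective line with homogeneous coordinates `[x : y]`. -/
def ofHomogeneous (p : K × K) : OnePoint K := if p.2 = 0 then ∞ else ↑(p.1 / p.2)

theorem ofHomogeneous_coe_one (x : K) : ofHomogeneous (x, 1) = (x : OnePoint K) := by
  simp [ofHomogeneous]

theorem ofHomogeneous_one_zero : ofHomogeneous ((1 : K), 0) = ∞ := by
  simp [ofHomogeneous]

theorem equivProjectivization_symm_mk_eq_ofHomogeneous (v : Fin 2 → K) (hv : v ≠ 0) :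
    (equivProjectivization K).symm (Projectivization.mk K v hv) = ofHomogeneous (v 0, v 1) := by
  simp [ofHomogeneous, div_eq_inv_mul]

theorem smul_ofHomogeneous (g : GL (Fin 2) K) {p : K × K} (hp : p ≠ 0) :
    g • ofHomogeneous p =
      ofHomogeneous (g 0 0 * p.1 + g 0 1 * p.2, g 1 0 * p.1 + g 1 1 * p.2) := by
  have hv : ![p.1, p.2] ≠ 0 := fun h => hp (Prod.ext (congrFun h 0) (congrFun h 1))
  have h := equivProjectivization_symm_mk_eq_ofHomogeneous _ hv
  simp only [Matrix.cons_val_zero, Matrix.cons_val_one, Prod.mk.eta] at h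
  rw [← h, Equiv.smul_def, Equiv.apply_symm_apply, Projectivization.smul_mk,
    equivProjectivization_symm_mk_eq_ofHomogeneous]
  simp

end Field

theorem tendsto_coe_cobounded {E : Type*} [NormedField E] [ProperSpace E] :
    Tendsto ((↑) : E → OnePoint E) (Bornology.cobounded E) (𝓝 ∞) := by
  rw [Metric.cobounded_eq_cocompact, ← coclosedCompact_eq_cocompact]
  exact tendsto_coe_infty

variable {K : Type*} [NontriviallyNormedField K] [ProperSpace K] [DecidableEq K]

theorem continuousAt_ofHomogeneous {p : K × K} (hp : p ≠ 0) :
    ContinuousAt (ofHomogeneous : K × K → OnePoint K) p := by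
  by_cases h : p.2 = 0
  · have h1 : p.1 ≠ 0 := fun h' => hp (Prod.ext h' h)
    -- The chart at infinity, in the coordinate `u = y / x`.
    let F : K → OnePoint K := fun u => if u = 0 then ∞ else ↑u⁻¹
    have hF : ContinuousAt F 0 := by
      rw [continuousAt_iff_punctured_nhds]
      have hF0 : F 0 = ∞ := if_pos rfl
      rw [hF0]
      refine (tendsto_coe_cobounded.comp tendsto_inv₀_nhdsNE_zero).congr' ?_
      filter_upwards [self_mem_nhdsWithin] with u hu
      exact (if_neg hu).symm
    have hd : ContinuousAt (fun q : K × K => q.2 / q.1) p :=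
      continuousAt_snd.div continuousAt_fst h1
    have hc := ContinuousAt.comp (x := p) (g := F) (by rwa [h, zero_div]) hd
    refine hc.congr ?_
    filter_upwards [continuousAt_fst.eventually_ne h1] with q hq
    by_cases hq2 : q.2 = 0 <;> simp [F, ofHomogeneous, hq, hq2]
  · have hc : ContinuousAt (fun q : K × K => ((q.1 / q.2 : K) : OnePoint K)) p :=
      continuous_coe.continuousAt.comp (continuousAt_fst.div continuousAt_snd h)
    refine hc.congr ?_
    filter_upwards [continuousAt_snd.eventually_ne h] with q hq
    simp [ofHomogeneous, hq]

/-- Homographies are continuous on the projective line. -/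
instance continuousConstSMul_GL : ContinuousConstSMul (GL (Fin 2) K) (OnePoint K) where
  continuous_const_smul g := by
    -- Upstairs the homography is linear and does not vanish off the origin, so `∞` and the poles
    -- need no separate treatment.
    have key : ∀ p : K × K, p ≠ 0 →
        ContinuousAt (fun q : K × K => g • ofHomogeneous q) p := by
      intro p hp
      have hne : (g 0 0 * p.1 + g 0 1 * p.2, g 1 0 * p.1 + g 1 1 * p.2) ≠ 0 := by
        intro h
        have h0 : g • ![p.1, p.2] = 0 := by
          have := Prod.ext_iff.1 h
          simp only [Prod.fst_zero, Prod.snd_zero] at this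
          simp [this.1, this.2]
        rw [smul_eq_zero_iff_eq] at h0
        exact hp (Prod.ext (congrFun h0 0) (congrFun h0 1))
      have hc := ContinuousAt.comp (x := p)
        (f := fun q : K × K => (g 0 0 * q.1 + g 0 1 * q.2, g 1 0 * q.1 + g 1 1 * q.2))
        (continuousAt_ofHomogeneous hne) (by fun_prop)
      refine hc.congr ?_
      filter_upwards [isOpen_ne.mem_nhds hp] with q hq
      exact (smul_ofHomogeneous g hq).symm
    rw [continuous_iff_continuousAt]
    intro x
    induction x with
    | infty =>
      rw [continuousAt_infty', coclosedCompact_eq_cocompact, ← Metric.cobounded_eq_cocompact,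
        ← ofHomogeneous_one_zero]
      have h1 : Tendsto (fun t : K => ((1 : K), t⁻¹)) (Bornology.cobounded K) (𝓝 (1, 0)) :=
        tendsto_const_nhds.prodMk_nhds tendsto_inv₀_cobounded
      refine ((key (1, 0) (by simp)).tendsto.comp h1).congr' ?_
      have h2 : ∀ᶠ t : K in Bornology.cobounded K, t ≠ 0 := Bornology.eventually_ne_cobounded 0
      filter_upwards [h2] with t ht
      simp [ofHomogeneous, ht]
    | coe t =>
      rw [continuousAt_coe]
      have h1 : ContinuousAt (fun t : K => (t, (1 : K))) t := by fun_prop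
      refine (ContinuousAt.comp (x := t) (f := fun t : K => (t, (1 : K)))
        (key (t, 1) (by simp)) h1).congr (Eventually.of_forall fun s => ?_)
      simp [ofHomogeneous]

end OnePoint

/-! ### Alternating words and ping-pong. -/

section PingPong

variable {G : Type*} [Group G]

/-- The nonempty alternating products of nonzero powers of `s true` and `s false`, indexed by the
generator whose power comes first. -/
inductive IsAlternating (s : Bool → G) : Bool → G → Prop
  | zpow (i : Bool) (n : ℤ) (hn : n ≠ 0) : IsAlternating s i (s i ^ n)
  | zpow_mul (i : Bool) (n : ℤ) (hn : n ≠ 0) (g : G) (hg : IsAlternating s (!i) g) :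
      IsAlternating s i (s i ^ n * g)

/-- A new power is either prepended or merged with the leading one. If merging cancels the leading
power, the tail that remains is already alternating, or is empty. -/
theorem IsAlternating.zpow_mul_eq_one_or {s : Bool → G} {i j : Bool} {g : G}
    (hg : IsAlternating s j g) (m : ℤ) :
    s i ^ m * g = 1 ∨ ∃ k, IsAlternating s k (s i ^ m * g) := by
  rcases eq_or_ne m 0 with rfl | hm
  · exact .inr ⟨j, by simpa using hg⟩
  rcases Bool.eq_or_eq_not j i with rfl | rfl
  · cases hg with
    | zpow _ n hn =>
      rw [← zpow_add]
      rcases eq_or_ne (m + n) 0 with h | h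
      · exact .inl (by simp [h])
      · exact .inr ⟨_, .zpow _ _ h⟩
    | zpow_mul _ n hn g hg =>
      rw [← mul_assoc, ← zpow_add]
      rcases eq_or_ne (m + n) 0 with h | h
      · exact .inr ⟨_, by simpa [h] using hg⟩
      · exact .inr ⟨_, .zpow_mul _ _ h _ hg⟩
  · exact .inr ⟨_, .zpow_mul _ _ hm _ hg⟩

theorem eq_one_or_isAlternating_of_mem_closure {s : Bool → G} {g : G}
    (hg : g ∈ Subgroup.closure (Set.range s)) : g = 1 ∨ ∃ i, IsAlternating s i g := by
  have step : ∀ (i : Bool) (m : ℤ), m ≠ 0 → ∀ y : G, (y = 1 ∨ ∃ j, IsAlternating s j y) →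
      s i ^ m * y = 1 ∨ ∃ j, IsAlternating s j (s i ^ m * y) := by
    rintro i m hm y (rfl | ⟨j, hj⟩)
    · exact .inr ⟨i, by simpa using IsAlternating.zpow i m hm⟩
    · exact hj.zpow_mul_eq_one_or m
  induction hg using Subgroup.closure_induction_left with
  | one => exact .inl rfl
  | mul_left x hx y _ ih =>
    obtain ⟨i, rfl⟩ := hx
    simpa using step i 1 one_ne_zero y ih
  | inv_mul_cancel x hx y _ ih =>
    obtain ⟨i, rfl⟩ := hx
    simpa using step i (-1) (by simp) y ih

variable {X : Type*} [MulAction G X]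

/-- The ping-pong lemma, for a point outside both of the players' sets. -/
theorem smul_mem_or_of_ping_pong {s : Bool → G} {S : Bool → Set X}
    (hdisj : Disjoint (S true) (S false))
    (hS : ∀ i (n : ℤ), n ≠ 0 → ∀ x, x ∉ S i → s i ^ n • x ∈ S i)
    {g : G} (hg : g ∈ Subgroup.closure (Set.range s)) (hg1 : g ≠ 1) {x : X}
    (hx : ∀ i, x ∉ S i) : ∃ i, g • x ∈ S i := by
  obtain ⟨i, hi⟩ := (eq_one_or_isAlternating_of_mem_closure hg).resolve_left hg1
  refine ⟨i, ?_⟩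
  clear hg hg1
  induction hi with
  | zpow i n hn => exact hS i n hn x (hx i)
  | zpow_mul i n hn g hg ih =>
    rw [mul_smul]
    refine hS i n hn _ fun h => ?_
    cases i
    · exact Set.disjoint_left.1 hdisj ih h
    · exact Set.disjoint_left.1 hdisj h ih

end PingPong

/-! ### Limit sets of subgroups of `PSL(2, ℝ)`. -/

namespace DiscoGroup

open Filter Topology Matrix OnePoint

theorem coe_smul_onePoint (g : SL(2, ℝ)) (x : OnePoint ℝ) :
    (g : PSL(2, ℝ)) • x = SpecialLinearGroup.toGL g • x := rfl

theorem coe_smul_upperHalfPlane (g : SL(2, ℝ)) (z : ℍ) : (g : PSL(2, ℝ)) • z = g • z := rfl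

instance : ContinuousConstSMul PSL(2, ℝ) (OnePoint ℝ) where
  continuous_const_smul g := by
    induction g using QuotientGroup.induction_on with
    | H g => exact continuous_const_smul (SpecialLinearGroup.toGL g)

instance (Φ : Subgroup PSL(2, ℝ)) : ContinuousConstSMul Φ (OnePoint ℝ) where
  continuous_const_smul g := continuous_const_smul (g : PSL(2, ℝ))

theorem boundaryPoint_coe_smul (g : SL(2, ℝ)) (x : OnePoint ℝ) :
    boundaryPoint ((g : PSL(2, ℝ)) • x) =
      (SpecialLinearGroup.toGL g).map Complex.ofRealHom • boundaryPoint x :=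
  map_smul Complex.ofRealHom (SpecialLinearGroup.toGL g) x

theorem planePoint_coe_smul (g : SL(2, ℝ)) (z : ℍ) :
    planePoint ((g : PSL(2, ℝ)) • z) =
      (SpecialLinearGroup.toGL g).map Complex.ofRealHom • planePoint z := by
  have h := UpperHalfPlane.denom_ne_zero (SpecialLinearGroup.toGL g) z
  rw [UpperHalfPlane.denom] at h
  rw [coe_smul_upperHalfPlane, planePoint, planePoint, smul_some_eq_ite, if_neg (by simpa using h),
    UpperHalfPlane.coe_specialLinearGroup_apply]
  simp

theorem planePoint_ne_boundaryPoint (z : ℍ) (x : OnePoint ℝ) : planePoint z ≠ boundaryPoint x := by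
  intro h
  induction x with
  | infty => exact coe_ne_infty _ h
  | coe x =>
    have h1 : (z : ℂ) = (x : ℂ) := coe_injective h
    have h2 := congrArg Complex.im h1
    simp only [Complex.ofReal_im] at h2
    exact z.im_pos.ne' h2

/-- The orbit stays in the plane and never hits a boundary point, so puncturing the neighbourhoods
makes no difference. -/
theorem mem_limitSet_iff {Φ : Subgroup PSL(2, ℝ)} {z₀ : ℍ} {x : OnePoint ℝ} :
    x ∈ limitSet Φ z₀ ↔ boundaryPoint x ∈ closure (planePoint '' MulAction.orbit Φ z₀) := by
  have h : boundaryPoint x ∉ planePoint '' MulAction.orbit Φ z₀ := by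
    rintro ⟨z, -, hz⟩
    exact planePoint_ne_boundaryPoint z x hz
  rw [limitSet, Set.mem_ofPred_eq, accPt_iff_clusterPt, mem_closure_iff_clusterPt, inf_principal,
    Set.inter_eq_right.2 fun y hy => by rintro rfl; exact h hy]

theorem smul_mem_limitSet {Φ : Subgroup PSL(2, ℝ)} {z₀ : ℍ} {g : PSL(2, ℝ)} (hg : g ∈ Φ)
    {x : OnePoint ℝ} (hx : x ∈ limitSet Φ z₀) : g • x ∈ limitSet Φ z₀ := by
  rw [mem_limitSet_iff] at hx ⊢
  induction g using QuotientGroup.induction_on with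
  | H g =>
    rw [boundaryPoint_coe_smul]
    refine map_mem_closure (continuous_const_smul _) hx ?_
    rintro _ ⟨z, ⟨k, rfl⟩, rfl⟩
    exact ⟨_, ⟨⟨(g : PSL(2, ℝ)), hg⟩ * k, rfl⟩, by
      rw [← planePoint_coe_smul]
      exact congrArg planePoint (mul_smul (g : PSL(2, ℝ)) (k : PSL(2, ℝ)) z₀)⟩

theorem smul_mem_limitSet_iff {Φ : Subgroup PSL(2, ℝ)} {z₀ : ℍ} {g : PSL(2, ℝ)} (hg : g ∈ Φ)
    {x : OnePoint ℝ} : g • x ∈ limitSet Φ z₀ ↔ x ∈ limitSet Φ z₀ :=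
  ⟨fun h => by simpa using smul_mem_limitSet (inv_mem hg) h, smul_mem_limitSet hg⟩

theorem isOpen_discontinuitySet (Φ : Subgroup PSL(2, ℝ)) (z₀ : ℍ) :
    IsOpen (discontinuitySet Φ z₀) := by
  have h : limitSet Φ z₀ =
      boundaryPoint ⁻¹' closure (planePoint '' MulAction.orbit Φ z₀) := by
    ext x; exact mem_limitSet_iff
  have hc : Continuous boundaryPoint := by
    refine OnePoint.continuous_map Complex.continuous_ofReal ?_
    rw [coclosedCompact_eq_cocompact, coclosedCompact_eq_cocompact]
    exact Complex.isometry_ofReal.isClosedEmbedding.tendsto_cocompact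
  rw [discontinuitySet, h]
  exact (isClosed_closure.preimage hc).isOpen_compl

/-- A sequence of orbit points converging to a boundary point puts it in the limit set. -/
theorem mem_limitSet_of_tendsto {Φ : Subgroup PSL(2, ℝ)} {z₀ : ℍ} {x : OnePoint ℝ}
    {g : ℕ → PSL(2, ℝ)} (hg : ∀ n, g n ∈ Φ)
    (h : Tendsto (fun n => planePoint (g n • z₀)) atTop (𝓝 (boundaryPoint x))) :
    x ∈ limitSet Φ z₀ :=
  mem_limitSet_iff.2 <| mem_closure_of_tendsto h <| Eventually.of_forall fun n =>
    ⟨_, ⟨⟨g n, hg n⟩, rfl⟩, rfl⟩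

/-! ### Powers of the generators. -/

/-- The two generators of `Γ`, as a family. -/
noncomputable def gen (i : Bool) : PSL(2, ℝ) := bif i then (A : PSL(2, ℝ)) else (B : PSL(2, ℝ))

theorem closure_range_gen : Subgroup.closure (Set.range gen) = Γ := by
  rw [Bool.range_eq, Set.pair_comm]; rfl

theorem A_mem_Γ : (A : PSL(2, ℝ)) ∈ Γ := Subgroup.subset_closure (by simp)

theorem B_mem_Γ : (B : PSL(2, ℝ)) ∈ Γ := Subgroup.subset_closure (by simp)

theorem coe_A_zpow (n : ℤ) : (A ^ n).val = !![1, 6 * (n : ℝ); 0, 1] := by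
  have hA : A.val = !![1, 6; 0, 1] := rfl
  induction n using Int.induction_on with
  | zero => simp [one_fin_two]
  | succ n ih =>
    rw [_root_.zpow_add_one]
    change (A ^ (n : ℤ)).val * A.val = _
    rw [ih, hA]
    simp [mul_add, add_comm]
  | pred n ih =>
    rw [_root_.zpow_sub_one]
    change (A ^ (-n : ℤ)).val * A.val.adjugate = _
    rw [ih, hA]
    simp [adjugate_fin_two]
    ring

theorem coe_B_zpow (n : ℤ) : (B ^ n).val = !![1, 0; 3 / 2 * (n : ℝ), 1] := by
  have hB : B.val = !![1, 0; 3 / 2, 1] := rfl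
  induction n using Int.induction_on with
  | zero => simp [one_fin_two]
  | succ n ih =>
    rw [_root_.zpow_add_one]
    change (B ^ (n : ℤ)).val * B.val = _
    rw [ih, hB]
    simp [mul_add]
  | pred n ih =>
    rw [_root_.zpow_sub_one]
    change (B ^ (-n : ℤ)).val * B.val.adjugate = _
    rw [ih, hB]
    simp [adjugate_fin_two]
    ring

theorem smul_ofHomogeneous_of_coe_eq {g : SL(2, ℝ)} {a b c d : ℝ} (hg : g.val = !![a, b; c, d])
    {p : ℝ × ℝ} (hp : p ≠ 0) :
    (g : PSL(2, ℝ)) • ofHomogeneous p = ofHomogeneous (a * p.1 + b * p.2, c * p.1 + d * p.2) := by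
  have h : ∀ i j, SpecialLinearGroup.toGL g i j = g.val i j := fun _ _ => rfl
  rw [coe_smul_onePoint, smul_ofHomogeneous _ hp]
  simp only [h, hg]
  simp

theorem coe_smul_of_coe_eq {g : SL(2, ℝ)} {a b c d : ℝ} (hg : g.val = !![a, b; c, d]) (z : ℍ) :
    (((g : PSL(2, ℝ)) • z : ℍ) : ℂ) = (a * z + b) / (c * z + d) := by
  rw [coe_smul_upperHalfPlane, UpperHalfPlane.coe_specialLinearGroup_apply]
  simp only [hg]
  simp

theorem A_zpow_smul_ofHomogeneous (n : ℤ) {p : ℝ × ℝ} (hp : p ≠ 0) :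
    (A : PSL(2, ℝ)) ^ n • ofHomogeneous p = ofHomogeneous (p.1 + 6 * n * p.2, p.2) := by
  rw [← QuotientGroup.mk_zpow, smul_ofHomogeneous_of_coe_eq (coe_A_zpow n) hp]
  simp

theorem B_zpow_smul_ofHomogeneous (n : ℤ) {p : ℝ × ℝ} (hp : p ≠ 0) :
    (B : PSL(2, ℝ)) ^ n • ofHomogeneous p = ofHomogeneous (p.1, 3 / 2 * n * p.1 + p.2) := by
  rw [← QuotientGroup.mk_zpow, smul_ofHomogeneous_of_coe_eq (coe_B_zpow n) hp]
  simp

theorem A_zpow_smul_coe (n : ℤ) (t : ℝ) :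
    (A : PSL(2, ℝ)) ^ n • (t : OnePoint ℝ) = ((t + 6 * n : ℝ) : OnePoint ℝ) := by
  rw [← ofHomogeneous_coe_one, A_zpow_smul_ofHomogeneous _ (by simp)]
  simp [ofHomogeneous]

theorem B_zpow_smul_inv (n : ℤ) {u : ℝ} (hu : u + 3 / 2 * n ≠ 0) :
    (B : PSL(2, ℝ)) ^ n • ofHomogeneous (1, u) = (((u + 3 / 2 * n)⁻¹ : ℝ) : OnePoint ℝ) := by
  rw [B_zpow_smul_ofHomogeneous _ (by simp)]
  have h : 3 / 2 * (n : ℝ) + u ≠ 0 := by rwa [add_comm]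
  simp [ofHomogeneous, h, add_comm u]

theorem coe_A_zpow_smul (n : ℤ) (z : ℍ) :
    (((A : PSL(2, ℝ)) ^ n • z : ℍ) : ℂ) = z + 6 * n := by
  rw [← QuotientGroup.mk_zpow, coe_smul_of_coe_eq (coe_A_zpow n)]
  simp

theorem coe_B_zpow_smul_inv (n : ℤ) (z : ℍ) :
    ((((B : PSL(2, ℝ)) ^ n • z : ℍ) : ℂ))⁻¹ = (z : ℂ)⁻¹ + 3 / 2 * n := by
  have := z.ne_zero
  rw [← QuotientGroup.mk_zpow, coe_smul_of_coe_eq (coe_B_zpow n)]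
  simp
  field_simp
  ring

end DiscoGroup

/-! ### Ping-pong on the circle and in the plane. -/

namespace DiscoGroup

open Filter Topology OnePoint

theorem one_le_or_le_neg_one {n : ℤ} (hn : n ≠ 0) : (1 : ℝ) ≤ n ∨ (n : ℝ) ≤ -1 := by
  rcases lt_or_gt_of_ne hn with h | h
  · right; exact_mod_cast (by omega : n ≤ -1)
  · left; exact_mod_cast (by omega : 1 ≤ n)

/-- The complements in `ℝℙ¹` of half-open fundamental domains of the cyclic groups generated by
`A` and by `B`. -/
def boundarySet : Bool → Set (OnePoint ℝ)
  | true => {x | ∀ t : ℝ, x = t → t < -2 ∨ 4 ≤ t}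
  | false => (↑) '' Set.Ico (-2 : ℝ) 1

/-- The complements in `ℍ` of half-open fundamental domains of the cyclic groups generated by
`A` and by `B`. -/
def planeSet : Bool → Set ℍ
  | true => {z | z.re < -2 ∨ 4 ≤ z.re}
  | false => {z | ((z : ℂ)⁻¹).re ≤ -1 / 2 ∨ 1 < ((z : ℂ)⁻¹).re}

theorem coe_notMem_boundarySet_iff {t : ℝ} :
    (∀ i, (t : OnePoint ℝ) ∉ boundarySet i) ↔ t ∈ Set.Ico (1 : ℝ) 4 := by
  simp only [Bool.forall_bool, boundarySet]
  simp
  grind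

/-- The half-open conventions matter: `-2` must belong to the set of `B` only, while `4` and `∞`
belong to that of `A`. -/
theorem disjoint_boundarySet : Disjoint (boundarySet true) (boundarySet false) := by
  rw [Set.disjoint_left]
  rintro _ h ⟨t, ht, rfl⟩
  rcases h t rfl with h | h <;> grind

/-- The shift `6` is the length of `[-2, 4)`, and the shift `3 / 2` is the length of `(-1/2, 1]`,
the domain of `B` in the coordinate `1 / t`. -/
theorem gen_zpow_smul_mem_boundarySet (i : Bool) (n : ℤ) (hn : n ≠ 0) (x : OnePoint ℝ)
    (hx : x ∉ boundarySet i) : gen i ^ n • x ∈ boundarySet i := by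
  have hn' := one_le_or_le_neg_one hn
  cases i with
  | true =>
    simp only [boundarySet, Set.mem_ofPred_eq] at hx
    push Not at hx
    obtain ⟨t, rfl, h1, h2⟩ := hx
    change (A : PSL(2, ℝ)) ^ n • (t : OnePoint ℝ) ∈ _
    rw [A_zpow_smul_coe]
    intro s hs
    rw [OnePoint.coe_eq_coe] at hs
    rcases hn' with h | h
    · right; linarith
    · left; linarith
  | false =>
    obtain ⟨u, hu1, hu2, rfl⟩ : ∃ u : ℝ, -1 / 2 < u ∧ u ≤ 1 ∧ x = ofHomogeneous (1, u) := by
      induction x with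
      | infty => exact ⟨0, by norm_num, by norm_num, ofHomogeneous_one_zero.symm⟩
      | coe t =>
        have ht : t < -2 ∨ 1 ≤ t := by
          by_contra h
          push Not at h
          exact hx ⟨t, h, rfl⟩
        have ht0 : t ≠ 0 := by rintro rfl; norm_num at ht
        refine ⟨t⁻¹, ?_, ?_, by simp [ofHomogeneous, ht0]⟩
        · rcases ht with h | h
          · have := inv_strictAnti₀ (by norm_num : (0 : ℝ) < 2) (by linarith : (2 : ℝ) < -t)
            rw [inv_neg] at this
            linarith
          · have := inv_pos.2 (by linarith : 0 < t)
            linarith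
        · rcases ht with h | h
          · have := inv_lt_zero.2 (by linarith : t < 0)
            linarith
          · exact inv_le_one_of_one_le₀ h
    change (B : PSL(2, ℝ)) ^ n • _ ∈ _
    have h0 : 1 < u + 3 / 2 * n ∨ u + 3 / 2 * n ≤ -1 / 2 := by
      rcases hn' with h | h
      · left; linarith
      · right; linarith
    rw [B_zpow_smul_inv _ (by rcases h0 with h | h <;> linarith)]
    refine ⟨_, ?_, rfl⟩
    generalize u + 3 / 2 * (n : ℝ) = v at h0
    rcases h0 with h | h
    · exact ⟨by have := inv_pos.2 (by linarith : 0 < v); linarith, inv_lt_one_of_one_lt₀ h⟩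
    · have h1 := inv_lt_zero.2 (by linarith : v < 0)
      have h2 := inv_anti₀ (by norm_num : (0 : ℝ) < 1 / 2) (by linarith : (1 / 2 : ℝ) ≤ -v)
      rw [inv_neg] at h2
      exact ⟨by linarith, by linarith⟩

/-- The half-open interval `[1, 4)` meets each `Γ`-orbit at most once, with trivial stabilizers. -/
theorem eq_one_of_smul_coe_eq_coe {g : PSL(2, ℝ)} (hg : g ∈ Γ) {s t : ℝ}
    (hs : s ∈ Set.Ico (1 : ℝ) 4) (ht : t ∈ Set.Ico (1 : ℝ) 4)
    (h : g • (s : OnePoint ℝ) = t) : g = 1 := by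
  by_contra hg1
  rw [← closure_range_gen] at hg
  obtain ⟨i, hi⟩ := smul_mem_or_of_ping_pong disjoint_boundarySet gen_zpow_smul_mem_boundarySet hg
    hg1 (coe_notMem_boundarySet_iff.2 hs)
  rw [h] at hi
  exact coe_notMem_boundarySet_iff.2 ht i hi

theorem normSq_inv_re_mul (z : ℍ) :
    0 < z.re ^ 2 + z.im ^ 2 ∧ ((z : ℂ)⁻¹).re * (z.re ^ 2 + z.im ^ 2) = z.re := by
  have h : 0 < z.re ^ 2 + z.im ^ 2 := by have := z.im_pos; positivity
  refine ⟨h, ?_⟩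
  rw [Complex.inv_re, Complex.normSq_apply, UpperHalfPlane.coe_re, UpperHalfPlane.coe_im,
    ← sq, ← sq]
  field_simp

/-- In `ℍ`, `Re (1 / z) > 1` cuts out the half-disc over `(0, 1)`. Likewise, in the next lemma, `Re
(1 / z) ≤ -1 / 2` is the half-disc over `(-2, 0)`. -/
theorem inv_re_le_one {z : ℍ} (h : z.re ≤ 0 ∨ 1 ≤ z.re) : ((z : ℂ)⁻¹).re ≤ 1 := by
  obtain ⟨h0, h1⟩ := normSq_inv_re_mul z
  have := z.im_pos
  by_contra! h2
  have h3 := mul_lt_mul_of_pos_right h2 h0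
  rcases h with h | h <;> nlinarith

theorem neg_half_lt_inv_re {z : ℍ} (h : z.re ≤ -2 ∨ 0 ≤ z.re) : -1 / 2 < ((z : ℂ)⁻¹).re := by
  obtain ⟨h0, h1⟩ := normSq_inv_re_mul z
  have := z.im_pos
  by_contra! h2
  have h3 := mul_le_mul_of_nonneg_right h2 h0.le
  rcases h with h | h <;> nlinarith

theorem disjoint_planeSet : Disjoint (planeSet true) (planeSet false) := by
  rw [Set.disjoint_left]
  rintro z (h | h) (h' | h')
  · linarith [neg_half_lt_inv_re (z := z) (.inl h.le)]
  · linarith [inv_re_le_one (z := z) (.inl (by linarith))]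
  · linarith [neg_half_lt_inv_re (z := z) (.inr (by linarith))]
  · linarith [inv_re_le_one (z := z) (.inr (by linarith))]

theorem re_A_zpow_smul (n : ℤ) (z : ℍ) : ((A : PSL(2, ℝ)) ^ n • z).re = z.re + 6 * n := by
  rw [← UpperHalfPlane.coe_re, coe_A_zpow_smul]
  simp

theorem inv_re_B_zpow_smul (n : ℤ) (z : ℍ) :
    ((((B : PSL(2, ℝ)) ^ n • z : ℍ) : ℂ)⁻¹).re = ((z : ℂ)⁻¹).re + 3 / 2 * n := by
  rw [coe_B_zpow_smul_inv, Complex.add_re]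
  congr 1
  have : (3 / 2 * n : ℂ) = ((3 / 2 * n : ℝ) : ℂ) := by push_cast; rfl
  rw [this, Complex.ofReal_re]

theorem gen_zpow_smul_mem_planeSet (i : Bool) (n : ℤ) (hn : n ≠ 0) (z : ℍ)
    (hz : z ∉ planeSet i) : gen i ^ n • z ∈ planeSet i := by
  have hn' := one_le_or_le_neg_one hn
  cases i with
  | true =>
    change ((A : PSL(2, ℝ)) ^ n • z).re < -2 ∨ 4 ≤ ((A : PSL(2, ℝ)) ^ n • z).re
    change ¬ (z.re < -2 ∨ 4 ≤ z.re) at hz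
    push Not at hz
    rw [re_A_zpow_smul]
    rcases hn' with h | h
    · right; linarith
    · left; linarith
  | false =>
    change ((((B : PSL(2, ℝ)) ^ n • z : ℍ) : ℂ)⁻¹).re ≤ -1 / 2 ∨
      1 < ((((B : PSL(2, ℝ)) ^ n • z : ℍ) : ℂ)⁻¹).re
    change ¬ (((z : ℂ)⁻¹).re ≤ -1 / 2 ∨ 1 < ((z : ℂ)⁻¹).re) at hz
    push Not at hz
    rw [inv_re_B_zpow_smul]
    rcases hn' with h | h
    · right; linarith
    · left; linarith

theorem subsingleton_orbit_inter (z₀ : ℍ) :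
    (MulAction.orbit Γ z₀ ∩ {z | ∀ i, z ∉ planeSet i}).Subsingleton := by
  rintro _ ⟨⟨g, rfl⟩, hg⟩ _ ⟨⟨k, rfl⟩, hk⟩
  have hmem : ((k * g⁻¹ : Γ) : PSL(2, ℝ)) ∈ Subgroup.closure (Set.range gen) := by
    rw [closure_range_gen]; exact (k * g⁻¹).2
  have h1 : ((k * g⁻¹ : Γ) : PSL(2, ℝ)) = 1 := by
    by_contra hne
    obtain ⟨i, hi⟩ := smul_mem_or_of_ping_pong disjoint_planeSet gen_zpow_smul_mem_planeSet hmem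
      hne hg
    have : ((k * g⁻¹ : Γ) : PSL(2, ℝ)) • (fun m : Γ => m • z₀) g = k • z₀ := by
      change (k * g⁻¹) • g • z₀ = _
      rw [smul_smul, inv_mul_cancel_right]
    rw [this] at hi
    exact hk i hi
  have h2 : k = g := by
    rw [← mul_inv_eq_one]
    exact Subtype.ext h1
  rw [h2]

/-- Every point of the strip `9 / 10 < Re z < 4` lies in one of three translates of the
fundamental domain of `Γ`. -/
theorem mem_or_mem_or_mem_of_re {z : ℍ} (h1 : 9 / 10 < z.re) (h4 : z.re < 4) :
    (∀ i, z ∉ planeSet i) ∨ (∀ i, (B : PSL(2, ℝ)) ^ (-1 : ℤ) • z ∉ planeSet i) ∨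
      (∀ i, (A : PSL(2, ℝ)) ^ (1 : ℤ) • (B : PSL(2, ℝ)) ^ (-1 : ℤ) • z ∉ planeSet i) := by
  have hD : ∀ w : ℍ, (∀ i, w ∉ planeSet i) ↔
      (-2 ≤ w.re ∧ w.re < 4) ∧ (-1 / 2 < ((w : ℂ)⁻¹).re ∧ ((w : ℂ)⁻¹).re ≤ 1) := by
    intro w
    simp only [Bool.forall_bool, planeSet, Set.mem_ofPred_eq, not_or, not_lt, not_le]
    tauto
  simp only [hD]
  obtain ⟨hz0, hz1⟩ := normSq_inv_re_mul z
  -- The left edge `9 / 10` leaves room around `1` while ensuring `10 / 9 - 3 / 2 < -1 / 3`, which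
  -- is used below to get `-3 < w.re`.
  have hu : ((z : ℂ)⁻¹).re ≤ 10 / 9 := by
    by_contra! h
    nlinarith [mul_lt_mul_of_pos_right h hz0, z.im_pos]
  by_cases hle : ((z : ℂ)⁻¹).re ≤ 1
  · exact .inl ⟨⟨by linarith, h4⟩, neg_half_lt_inv_re (.inr (by linarith)), hle⟩
  right
  push Not at hle
  have hw := inv_re_B_zpow_smul (-1) z
  have hA := re_A_zpow_smul 1 ((B : PSL(2, ℝ)) ^ (-1 : ℤ) • z)
  generalize (B : PSL(2, ℝ)) ^ (-1 : ℤ) • z = w at *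
  push_cast at hw hA
  obtain ⟨hw0, hw1⟩ := normSq_inv_re_mul w
  have hneg : w.re < 0 := by rw [← hw1]; exact mul_neg_of_neg_of_pos (by linarith) hw0
  by_cases h2 : -2 ≤ w.re
  · exact .inl ⟨⟨h2, by linarith⟩, by linarith, by linarith⟩
  right
  push Not at h2
  -- If `Re w ≤ -3`, then `Re (1 / w) ≥ 1 / Re w ≥ -1 / 3`. With the bound, `A` moves `w` into `3 <
  -- Re < 4`, clear of both half-discs.
  have hw3 : -3 < w.re := by
    by_contra! h
    have : ((w : ℂ)⁻¹).re < -1 / 3 := by linarith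
    nlinarith [mul_lt_mul_of_pos_right this hw0, w.im_pos]
  refine ⟨⟨by linarith, by linarith⟩, neg_half_lt_inv_re (.inr (by linarith)),
    inv_re_le_one (.inr (by linarith))⟩

/-! ### Which boundary points are limit points. -/

theorem coe_notMem_limitSet (z₀ : ℍ) {t : ℝ} (ht : t ∈ Set.Ico (1 : ℝ) 4) :
    (t : OnePoint ℝ) ∉ limitSet Γ z₀ := by
  rw [mem_limitSet_iff]
  intro hmem
  -- Each of the three covering translates contains at most one orbit point.
  have hfin : (MulAction.orbit Γ z₀ ∩ {z | 9 / 10 < z.re ∧ z.re < 4}).Finite := by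
    have hT := (subsingleton_orbit_inter z₀).finite
    have hpre : ∀ g ∈ Γ, ((fun z : ℍ => g • z) ⁻¹'
        (MulAction.orbit Γ z₀ ∩ {z | ∀ i, z ∉ planeSet i})).Finite := fun g _ =>
      hT.preimage (MulAction.injective g).injOn
    have horb : ∀ g ∈ Γ, ∀ z ∈ MulAction.orbit Γ z₀, g • z ∈ MulAction.orbit Γ z₀ := by
      rintro g hg _ ⟨k, rfl⟩
      exact ⟨⟨g, hg⟩ * k, mul_smul _ _ _⟩
    have hB : (B : PSL(2, ℝ)) ^ (-1 : ℤ) ∈ Γ := zpow_mem B_mem_Γ _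
    have hAB : (A : PSL(2, ℝ)) ^ (1 : ℤ) * (B : PSL(2, ℝ)) ^ (-1 : ℤ) ∈ Γ :=
      mul_mem (zpow_mem A_mem_Γ _) hB
    refine ((hT.union (hpre _ hB)).union (hpre _ hAB)).subset ?_
    rintro z ⟨hz, h1, h4⟩
    rcases mem_or_mem_or_mem_of_re h1 h4 with h | h | h
    · exact .inl (.inl ⟨hz, h⟩)
    · exact .inl (.inr ⟨horb _ hB _ hz, h⟩)
    · refine .inr ⟨horb _ hAB _ hz, ?_⟩
      change ∀ i, _ ∉ planeSet i
      simpa only [mul_smul] using h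
  have hU : IsOpen ((↑) '' {z : ℂ | 9 / 10 < z.re ∧ z.re < 4} : Set (OnePoint ℂ)) := by
    rw [isOpen_image_coe]
    exact (isOpen_lt continuous_const Complex.continuous_re).inter
      (isOpen_lt Complex.continuous_re continuous_const)
  have htU : boundaryPoint t ∈ ((↑) '' {z : ℂ | 9 / 10 < z.re ∧ z.re < 4} : Set (OnePoint ℂ)) :=
    ⟨(t : ℂ), ⟨by simp; linarith [ht.1], by simpa using ht.2⟩, rfl⟩
  have h1 := hU.inter_closure ⟨htU, hmem⟩
  have h2 : ((↑) '' {z : ℂ | 9 / 10 < z.re ∧ z.re < 4} : Set (OnePoint ℂ)) ∩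
      planePoint '' MulAction.orbit Γ z₀ ⊆
      planePoint '' (MulAction.orbit Γ z₀ ∩ {z | 9 / 10 < z.re ∧ z.re < 4}) := by
    rintro _ ⟨⟨w, hw, hwz⟩, z, hz, rfl⟩
    refine ⟨z, ⟨hz, ?_⟩, rfl⟩
    rw [planePoint, OnePoint.coe_eq_coe] at hwz
    subst hwz
    exact hw
  have h3 := closure_mono h2 h1
  rw [(hfin.image _).isClosed.closure_eq] at h3
  obtain ⟨z, -, hz⟩ := h3
  exact planePoint_ne_boundaryPoint z _ hz

theorem infty_mem_limitSet (z₀ : ℍ) : (∞ : OnePoint ℝ) ∈ limitSet Γ z₀ := by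
  refine mem_limitSet_of_tendsto (g := fun n : ℕ => (A : PSL(2, ℝ)) ^ (n : ℤ))
    (fun n => zpow_mem A_mem_Γ _) ?_
  change Tendsto (fun n : ℕ => (((((A : PSL(2, ℝ)) ^ (n : ℤ) • z₀ : ℍ) : ℂ)) : OnePoint ℂ)) atTop
    (𝓝 ∞)
  refine tendsto_coe_cobounded.comp ?_
  rw [← tendsto_norm_atTop_iff_cobounded]
  refine tendsto_atTop_mono (fun n => Complex.re_le_norm _) ?_
  simp only [UpperHalfPlane.coe_re, re_A_zpow_smul]
  refine tendsto_atTop_add_const_left _ _ ?_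
  exact ((tendsto_natCast_atTop_atTop (R := ℝ)).const_mul_atTop
    (by norm_num : (0 : ℝ) < 6)).congr (by simp)

theorem tendsto_B_zpow_smul (z₀ : ℍ) :
    Tendsto (fun n : ℕ => (((B : PSL(2, ℝ)) ^ (n : ℤ) • z₀ : ℍ) : ℂ)) atTop (𝓝 0) := by
  have h : Tendsto (fun n : ℕ => (((B : PSL(2, ℝ)) ^ (n : ℤ) • z₀ : ℍ) : ℂ)⁻¹) atTop
      (Bornology.cobounded ℂ) := by
    rw [← tendsto_norm_atTop_iff_cobounded]
    refine tendsto_atTop_mono (fun n => Complex.re_le_norm _) ?_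
    simp only [inv_re_B_zpow_smul]
    refine tendsto_atTop_add_const_left _ _ ?_
    exact ((tendsto_natCast_atTop_atTop (R := ℝ)).const_mul_atTop
      (by norm_num : (0 : ℝ) < 3 / 2)).congr (by simp)
  exact (tendsto_inv₀_cobounded.comp h).congr fun n => inv_inv _

theorem zero_mem_limitSet (z₀ : ℍ) : ((0 : ℝ) : OnePoint ℝ) ∈ limitSet Γ z₀ := by
  refine mem_limitSet_of_tendsto (g := fun n : ℕ => (B : PSL(2, ℝ)) ^ (n : ℤ))
    (fun n => zpow_mem B_mem_Γ _) ?_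
  have h := (continuous_coe (X := ℂ)).continuousAt.tendsto.comp (tendsto_B_zpow_smul z₀)
  simpa [boundaryPoint, planePoint, Function.comp_def] using h

/-- If `x` in `[-2, 1)` is not equivalent to a point of `[1, 4)`, nor to `0` or `∞`, then it is the
image of such a point under `B ^ m * A ^ k` with `k` and `m` nonzero. -/
theorem exists_preimage {x : ℝ} (hx : x ∈ Set.Ico (-2 : ℝ) 1)
    (h0 : ∀ g ∈ Γ, g • (x : OnePoint ℝ) ≠ (0 : ℝ)) (hinf : ∀ g ∈ Γ, g • (x : OnePoint ℝ) ≠ ∞)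
    (hI : ∀ g ∈ Γ, ∀ t ∈ Set.Ico (1 : ℝ) 4, g • (x : OnePoint ℝ) ≠ t) :
    ∃ k m : ℤ, k ≠ 0 ∧ m ≠ 0 ∧ ∃ y ∈ Set.Ico (-2 : ℝ) 1,
      (B : PSL(2, ℝ)) ^ m • (A : PSL(2, ℝ)) ^ k • (y : OnePoint ℝ) = x ∧
      x = ((y + 6 * k)⁻¹ + 3 / 2 * m)⁻¹ := by
  have hx0 : x ≠ 0 := by
    rintro rfl
    exact h0 1 (one_mem _) (one_smul _ _)
  -- Reduce into the domain of `B`, then below into that of `A`. Landing in `[1, 4)` is excluded, so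
  -- the result is again in `[-2, 1)`.
  obtain ⟨m, ⟨hm1, hm2⟩, -⟩ :=
    existsUnique_sub_zsmul_mem_Ioc (by norm_num : (0 : ℝ) < 3 / 2) x⁻¹ (-1 / 2)
  rw [zsmul_eq_mul, mul_comm] at hm1 hm2
  have hxu : ofHomogeneous (1, x⁻¹) = (x : OnePoint ℝ) := by simp [ofHomogeneous, hx0]
  have hu0 : x⁻¹ - 3 / 2 * m ≠ 0 := by
    intro h
    refine hinf _ (zpow_mem B_mem_Γ (-m)) ?_
    rw [← hxu, B_zpow_smul_ofHomogeneous _ (by simp)]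
    have : 3 / 2 * ((-m : ℤ) : ℝ) + x⁻¹ = 0 := by push_cast; linarith
    simp [ofHomogeneous] at this ⊢
    exact this
  set u := x⁻¹ - 3 / 2 * m with hu
  have hBx : (B : PSL(2, ℝ)) ^ (-m) • (x : OnePoint ℝ) = ((u⁻¹ : ℝ) : OnePoint ℝ) := by
    have e : x⁻¹ + 3 / 2 * ((-m : ℤ) : ℝ) = u := by push_cast; rw [hu]; ring
    rw [← hxu, B_zpow_smul_inv _ (by rwa [e]), e]
  obtain ⟨k, ⟨hk1, hk2⟩, -⟩ :=
    existsUnique_sub_zsmul_mem_Ico (by norm_num : (0 : ℝ) < 6) u⁻¹ (-2)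
  rw [zsmul_eq_mul, mul_comm] at hk1 hk2
  set y := u⁻¹ - 6 * k with hy
  have hAx : (A : PSL(2, ℝ)) ^ (-k) • (B : PSL(2, ℝ)) ^ (-m) • (x : OnePoint ℝ) = (y : ℝ) := by
    rw [hBx, A_zpow_smul_coe, hy]
    congr 1
    push_cast
    ring
  have hy1 : y < 1 := by
    by_contra! h
    refine hI (A ^ (-k) * B ^ (-m)) (mul_mem (zpow_mem A_mem_Γ _) (zpow_mem B_mem_Γ _)) y
      ⟨h, by linarith⟩ ?_
    rw [mul_smul, hAx]
  -- The interval `[-2, 1)` misses the domain of `B`; `0` survives only because `0⁻¹ = 0`. A zero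
  -- exponent would put `x` or `u⁻¹` in both.
  have hout : ∀ w : ℝ, w ∈ Set.Ico (-2 : ℝ) 1 → -1 / 2 < w⁻¹ → w⁻¹ ≤ 1 → w = 0 := by
    rintro w ⟨h1, h2⟩ h3 h4
    rcases lt_trichotomy w 0 with h | h | h
    · nlinarith [mul_inv_cancel₀ h.ne]
    · exact h
    · nlinarith [mul_inv_cancel₀ h.ne']
  have hm0 : m ≠ 0 := by
    rintro rfl
    have hux : u = x⁻¹ := by rw [hu]; simp
    rw [hux] at hm1 hm2
    exact hx0 (hout x hx hm1 (by linarith))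
  have hk0 : k ≠ 0 := by
    rintro rfl
    have hyu : y = u⁻¹ := by rw [hy]; simp
    refine inv_ne_zero hu0 (hout _ ?_ (by rwa [inv_inv]) (by rw [inv_inv]; linarith))
    rw [← hyu]
    exact ⟨hk1, hy1⟩
  refine ⟨k, m, hk0, hm0, y, ⟨hk1, hy1⟩, ?_, ?_⟩
  · rw [← hAx, zpow_neg, zpow_neg, smul_inv_smul, smul_inv_smul]
  · rw [hy, sub_add_cancel, inv_inv, hu, sub_add_cancel, inv_inv]

/-- For nonzero `k` and `m`, the map `B ^ m * A ^ k` contracts the strip `-2 ≤ Re z ≤ 1`. -/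
theorem norm_sub_le_of_inv {k m : ℤ} (hk : k ≠ 0) (hm : m ≠ 0) {z w z' w' : ℂ}
    (hz : -2 ≤ z.re ∧ z.re ≤ 1) (hw : -2 ≤ w.re ∧ w.re ≤ 1)
    (hz' : z' = ((z + 6 * k)⁻¹ + 3 / 2 * m)⁻¹) (hw' : w' = ((w + 6 * k)⁻¹ + 3 / 2 * m)⁻¹) :
    (-2 ≤ z'.re ∧ z'.re ≤ 1) ∧ ‖z' - w'‖ ≤ ‖z - w‖ / 25 := by
  have hk' := one_le_or_le_neg_one hk
  have hm' := one_le_or_le_neg_one hm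
  have hM : (1 : ℝ) ≤ |(m : ℝ)| := by
    rcases hm' with h | h
    · exact h.trans (le_abs_self _)
    · rw [abs_of_neg (by linarith)]; linarith
  have hre : ∀ v : ℂ, (v + 6 * k).re = v.re + 6 * k := by intro v; simp
  have key : ∀ v : ℂ, -2 ≤ v.re ∧ v.re ≤ 1 → 4 ≤ |(v + 6 * k).re| := by
    rintro v ⟨h1, h2⟩
    rw [hre]
    rcases hk' with h | h
    · exact le_trans (by linarith) (le_abs_self _)
    · exact le_trans (by linarith) (neg_le_abs _)
  -- This is the denominator of the homography, at least `3 / 2 * 4 - 1 = 5` in norm. Two such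
  -- factors give the ratio `1 / 25`.
  have key2 : ∀ v : ℂ, -2 ≤ v.re ∧ v.re ≤ 1 → 5 ≤ ‖1 + 3 / 2 * m * (v + 6 * k)‖ := by
    intro v hv
    have h4 := key v hv
    have h6 : (6 : ℝ) ≤ |3 / 2 * m * (v + 6 * k).re| := by
      rw [abs_mul, abs_mul, abs_of_pos (by norm_num : (0 : ℝ) < 3 / 2)]
      nlinarith
    have h5 : (1 + 3 / 2 * m * (v + 6 * k) : ℂ).re = 1 + 3 / 2 * m * (v + 6 * k).re := by
      have : (3 / 2 * m : ℂ) = ((3 / 2 * m : ℝ) : ℂ) := by push_cast; rfl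
      rw [this, Complex.add_re, Complex.re_ofReal_mul, Complex.one_re]
    refine le_trans ?_ (Complex.abs_re_le_norm _)
    rw [h5]
    rcases le_abs.1 h6 with h | h
    · exact le_trans (by linarith) (le_abs_self _)
    · exact le_trans (by linarith) (neg_le_abs _)
  have hne : ∀ v : ℂ, -2 ≤ v.re ∧ v.re ≤ 1 → v + 6 * k ≠ 0 := by
    intro v hv h0
    have := key v hv
    rw [h0] at this
    norm_num at this
  have hne2 : ∀ v : ℂ, -2 ≤ v.re ∧ v.re ≤ 1 → 1 + 3 / 2 * m * (v + 6 * k) ≠ 0 := by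
    intro v hv h0
    have := key2 v hv
    rw [h0] at this
    norm_num at this
  have hform : ∀ v : ℂ, -2 ≤ v.re ∧ v.re ≤ 1 →
      ((v + 6 * k)⁻¹ + 3 / 2 * m)⁻¹ = (v + 6 * k) / (1 + 3 / 2 * m * (v + 6 * k)) := by
    intro v hv
    have h1 := hne v hv
    rw [← inv_div]
    field_simp
  constructor
  · have h1 : ‖(z + 6 * k)⁻¹‖ ≤ 1 / 4 := by
      rw [norm_inv, inv_le_comm₀ (norm_pos_iff.2 (hne z hz)) (by norm_num)]
      have := (key z hz).trans (Complex.abs_re_le_norm _)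
      linarith
    have h2 : ‖(3 / 2 * m : ℂ)‖ = 3 / 2 * |(m : ℝ)| := by simp
    have h3 : 1 ≤ ‖(z + 6 * k)⁻¹ + 3 / 2 * m‖ := by
      have := norm_sub_le ((z + 6 * k)⁻¹ + 3 / 2 * m) (z + 6 * k)⁻¹
      rw [add_sub_cancel_left, h2] at this
      linarith
    have h4 : ‖z'‖ ≤ 1 := by
      rw [hz', norm_inv]
      exact inv_le_one_of_one_le₀ h3
    have h5 := abs_le.1 ((Complex.abs_re_le_norm z').trans h4)
    exact ⟨by linarith [h5.1], h5.2⟩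
  · have hp := hne2 z hz
    have hq := hne2 w hw
    have h1 : z' - w' = (z - w) / ((1 + 3 / 2 * m * (z + 6 * k)) * (1 + 3 / 2 * m * (w + 6 * k))) := by
      rw [hz', hw', hform z hz, hform w hw, div_sub_div _ _ hp hq]
      congr 1
      ring
    rw [h1, norm_div, norm_mul]
    gcongr
    nlinarith [key2 z hz, key2 w hw]

/-- A point of `[-2, 1)` outside the translates of `[1, 4)` and not equivalent to `0` or `∞` attracts
the strip `-2 ≤ Re z ≤ 1` under elements of `Γ` that contract arbitrarily strongly. -/
theorem exists_contraction (n : ℕ) {x : ℝ} (hx : x ∈ Set.Ico (-2 : ℝ) 1)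
    (h0 : ∀ g ∈ Γ, g • (x : OnePoint ℝ) ≠ (0 : ℝ)) (hinf : ∀ g ∈ Γ, g • (x : OnePoint ℝ) ≠ ∞)
    (hI : ∀ g ∈ Γ, ∀ t ∈ Set.Ico (1 : ℝ) 4, g • (x : OnePoint ℝ) ≠ t) :
    ∃ g ∈ Γ, ∃ y ∈ Set.Ico (-2 : ℝ) 1, ∀ z : ℍ, -2 ≤ z.re ∧ z.re ≤ 1 →
      (-2 ≤ (g • z).re ∧ (g • z).re ≤ 1) ∧
      ‖((g • z : ℍ) : ℂ) - x‖ ≤ ‖(z : ℂ) - y‖ * (1 / 25) ^ n := by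
  induction n generalizing x with
  | zero => exact ⟨1, one_mem _, x, hx, fun z hz => by simpa using hz⟩
  | succ n ih =>
    -- Peel off one factor; `x₁` is equivalent to `x`, so it inherits all three exclusions.
    obtain ⟨k, m, hk, hm, x₁, hx₁, hsmul, hxx₁⟩ := exists_preimage hx h0 hinf hI
    have hfΓ : (B : PSL(2, ℝ)) ^ m * (A : PSL(2, ℝ)) ^ k ∈ Γ :=
      mul_mem (zpow_mem B_mem_Γ _) (zpow_mem A_mem_Γ _)
    have htrans : ∀ g : PSL(2, ℝ), g • (x₁ : OnePoint ℝ) =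
        (g * ((B : PSL(2, ℝ)) ^ m * (A : PSL(2, ℝ)) ^ k)⁻¹) • (x : OnePoint ℝ) := by
      intro g
      rw [← hsmul, mul_smul g, ← mul_smul ((B : PSL(2, ℝ)) ^ m), inv_smul_smul]
    have hmem : ∀ g ∈ Γ, g * ((B : PSL(2, ℝ)) ^ m * (A : PSL(2, ℝ)) ^ k)⁻¹ ∈ Γ :=
      fun g hg => mul_mem hg (inv_mem hfΓ)
    obtain ⟨g, hg, y, hy, H⟩ := ih hx₁ (fun g hg => htrans g ▸ h0 _ (hmem g hg))
      (fun g hg => htrans g ▸ hinf _ (hmem g hg))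
      (fun g hg => htrans g ▸ hI _ (hmem g hg))
    refine ⟨_, mul_mem hfΓ hg, y, hy, fun z hz => ?_⟩
    obtain ⟨H1, H2⟩ := H z hz
    have hform : (((((B : PSL(2, ℝ)) ^ m * (A : PSL(2, ℝ)) ^ k) * g) • z : ℍ) : ℂ) =
        ((((g • z : ℍ) : ℂ) + 6 * k)⁻¹ + 3 / 2 * m)⁻¹ := by
      rw [mul_smul, mul_smul, ← inv_inj, inv_inv, coe_B_zpow_smul_inv, coe_A_zpow_smul]
    have hx' : (x : ℂ) = (((x₁ : ℂ) + 6 * k)⁻¹ + 3 / 2 * m)⁻¹ := by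
      rw [hxx₁]; push_cast; rfl
    obtain ⟨H3, H4⟩ := norm_sub_le_of_inv hk hm (z := ((g • z : ℍ) : ℂ)) (w := (x₁ : ℂ)) H1
      ⟨by simpa using hx₁.1, by simpa using hx₁.2.le⟩ hform hx'
    refine ⟨H3, H4.trans ?_⟩
    rw [pow_succ, ← mul_assoc]
    linarith

/-- A boundary point outside the translates of `[1, 4)` lies in the limit set. -/
theorem mem_limitSet_of_forall_smul_ne (z₀ : ℍ) {x : OnePoint ℝ}
    (hI : ∀ g ∈ Γ, ∀ t ∈ Set.Ico (1 : ℝ) 4, g • x ≠ t) : x ∈ limitSet Γ z₀ := by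
  by_contra hx
  have h0 : ∀ g ∈ Γ, g • x ≠ (0 : ℝ) := fun g hg h =>
    hx ((smul_mem_limitSet_iff hg).1 (h ▸ zero_mem_limitSet z₀))
  have hinf : ∀ g ∈ Γ, g • x ≠ ∞ := fun g hg h =>
    hx ((smul_mem_limitSet_iff hg).1 (h ▸ infty_mem_limitSet z₀))
  obtain ⟨t, rfl⟩ : ∃ t : ℝ, (t : OnePoint ℝ) = x :=
    ne_infty_iff_exists.1 (by simpa using hinf 1 (one_mem _))
  obtain ⟨k, ⟨hk1, hk2⟩, -⟩ :=
    existsUnique_sub_zsmul_mem_Ico (by norm_num : (0 : ℝ) < 6) t (-2)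
  rw [zsmul_eq_mul, mul_comm] at hk1 hk2
  have hkΓ : (A : PSL(2, ℝ)) ^ (-k) ∈ Γ := zpow_mem A_mem_Γ _
  have hA : (A : PSL(2, ℝ)) ^ (-k) • (t : OnePoint ℝ) = ((t - 6 * k : ℝ) : OnePoint ℝ) := by
    rw [A_zpow_smul_coe]; push_cast; ring_nf
  have hlt : t - 6 * k < 1 := by
    by_contra! h
    exact hI _ hkΓ _ ⟨h, by linarith⟩ hA
  apply hx
  rw [← smul_mem_limitSet_iff hkΓ, hA]
  have hmem : ∀ g ∈ Γ, g * (A : PSL(2, ℝ)) ^ (-k) ∈ Γ := fun g hg => mul_mem hg hkΓ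
  have H := fun n => exists_contraction n ⟨hk1, hlt⟩
    (fun g hg => by rw [← hA, ← mul_smul]; exact h0 _ (hmem g hg))
    (fun g hg => by rw [← hA, ← mul_smul]; exact hinf _ (hmem g hg))
    (fun g hg => by rw [← hA, ← mul_smul]; exact hI _ (hmem g hg))
  choose g hg y hy H using H
  -- The base point may lie outside the strip; a power of `B` brings it near `0`. Its distance to `y
  -- n` is then at most `1 + 2 = 3`.
  obtain ⟨N, hN⟩ : ∃ N : ℕ, ‖(((B : PSL(2, ℝ)) ^ (N : ℤ) • z₀ : ℍ) : ℂ)‖ < 1 :=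
    ((tendsto_B_zpow_smul z₀).norm.eventually (gt_mem_nhds (by simp))).exists
  set w := (B : PSL(2, ℝ)) ^ (N : ℤ) • z₀ with hw
  have hwre := abs_le.1 ((Complex.abs_re_le_norm (w : ℂ)).trans hN.le)
  refine mem_limitSet_of_tendsto (g := fun n => g n * (B : PSL(2, ℝ)) ^ (N : ℤ))
    (fun n => mul_mem (hg n) (zpow_mem B_mem_Γ _)) ?_
  simp only [mul_smul, ← hw]
  refine (continuous_coe (X := ℂ)).continuousAt.tendsto.comp
    (x := atTop) (y := 𝓝 ((t - 6 * k : ℝ) : ℂ)) (f := fun n => ((g n • w : ℍ) : ℂ)) ?_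
  rw [tendsto_iff_norm_sub_tendsto_zero]
  have h3 : Tendsto (fun n : ℕ => (3 : ℝ) * (1 / 25) ^ n) atTop (𝓝 0) := by
    simpa using (tendsto_pow_atTop_nhds_zero_of_lt_one (by norm_num : (0 : ℝ) ≤ 1 / 25)
      (by norm_num)).const_mul 3
  refine squeeze_zero (fun n => norm_nonneg _) (fun n => ?_) h3
  refine (H n w ⟨by linarith [hwre.1, UpperHalfPlane.coe_re w], hwre.2⟩).2.trans ?_
  gcongr
  refine (norm_sub_le _ _).trans ?_
  have : ‖(y n : ℂ)‖ ≤ 2 := by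
    rw [Complex.norm_real, Real.norm_eq_abs, abs_le]
    exact ⟨(hy n).1, by linarith [(hy n).2]⟩
  linarith

theorem mem_discontinuitySet_iff {z₀ : ℍ} {x : OnePoint ℝ} :
    x ∈ discontinuitySet Γ z₀ ↔ ∃ g ∈ Γ, ∃ t ∈ Set.Ico (1 : ℝ) 4, g • x = t := by
  constructor
  · intro hx
    by_contra! h
    exact hx (mem_limitSet_of_forall_smul_ne z₀ h)
  · rintro ⟨g, hg, t, ht, h⟩ hx
    exact coe_notMem_limitSet z₀ ht (h ▸ smul_mem_limitSet hg hx)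

/-! ### The element `A * B⁻¹` and the fundamental interval. -/

theorem coe_A_mul_B_inv : (A * B⁻¹).val = !![-8, 6; -3 / 2, 1] := by
  have hA : A.val = !![1, 6; 0, 1] := rfl
  have hB : B.val = !![1, 0; 3 / 2, 1] := rfl
  change A.val * B.val.adjugate = _
  rw [hA, hB]
  simp [Matrix.adjugate_fin_two]
  norm_num

theorem A_mul_B_inv_mem_Γ : ((A * B⁻¹ : SL(2, ℝ)) : PSL(2, ℝ)) ∈ Γ :=
  mul_mem A_mem_Γ (inv_mem B_mem_Γ)

theorem isHyperbolic_A_mul_B_inv : (A * B⁻¹).val.IsHyperbolic := by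
  rw [Matrix.IsHyperbolic, coe_A_mul_B_inv, Matrix.discr_fin_two]
  simp [Matrix.trace_fin_two, Matrix.det_fin_two]
  norm_num

theorem direction_arctan {s : ℝ} (hs : s ≠ 0) :
    direction (Real.arctan s) = ((s⁻¹ : ℝ) : OnePoint ℝ) := by
  have h : √(1 + s ^ 2) ≠ 0 := (Real.sqrt_pos.2 (by positivity)).ne'
  rw [direction, equivProjectivization_symm_mk_eq_ofHomogeneous]
  simp [ofHomogeneous, Real.cos_arctan, Real.sin_arctan, hs, h]
  field_simp

theorem fundamentalInterval_eq : fundamentalInterval = (↑) '' Set.Icc (1 : ℝ) 4 := by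
  have hpos : 0 < Real.arctan (1 / 4) := Real.arctan_pos.2 (by norm_num)
  ext x
  constructor
  · rintro ⟨θ, ⟨h1, h2⟩, rfl⟩
    have hθ : Real.arctan (Real.tan θ) = θ := by
      refine Real.arctan_tan ?_ (h2.trans_lt (Real.arctan_lt_pi_div_two 1))
      linarith [Real.pi_pos]
    rw [← hθ] at h1 h2 ⊢
    rw [Real.arctan_le_arctan_iff] at h1 h2
    have h0 : 0 < Real.tan θ := by linarith
    rw [direction_arctan h0.ne']
    refine ⟨_, ⟨one_le_inv₀ h0 |>.2 h2, ?_⟩, rfl⟩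
    rw [inv_le_comm₀ h0 (by norm_num)]
    linarith
  · rintro ⟨t, ⟨h1, h2⟩, rfl⟩
    have h0 : 0 < t := by linarith
    refine ⟨Real.arctan t⁻¹, ⟨?_, ?_⟩, ?_⟩
    · rw [Real.arctan_le_arctan_iff, le_inv_comm₀ (by norm_num) h0]
      linarith
    · rw [Real.arctan_le_arctan_iff]
      exact inv_le_one_of_one_le₀ h1
    · rw [direction_arctan (inv_ne_zero h0.ne'), inv_inv]

theorem A_mul_B_inv_smul_one :
    ((A * B⁻¹ : SL(2, ℝ)) : PSL(2, ℝ)) • ((1 : ℝ) : OnePoint ℝ) = (4 : ℝ) := by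
  rw [← ofHomogeneous_coe_one, smul_ofHomogeneous_of_coe_eq coe_A_mul_B_inv (by simp)]
  norm_num [ofHomogeneous]

theorem four_mem_discontinuitySet (z₀ : ℍ) :
    ((4 : ℝ) : OnePoint ℝ) ∈ discontinuitySet Γ z₀ :=
  mem_discontinuitySet_iff.2 ⟨_, inv_mem A_mul_B_inv_mem_Γ, 1, ⟨le_rfl, by norm_num⟩, by
    rw [← A_mul_B_inv_smul_one, inv_smul_smul]⟩

theorem isFundamentalRegion_fundamentalInterval (z₀ : ℍ) :
    IsFundamentalRegion Γ (discontinuitySet Γ z₀) fundamentalInterval := by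
  have hsub : fundamentalInterval ⊆ discontinuitySet Γ z₀ := by
    rw [fundamentalInterval_eq]
    rintro _ ⟨t, ⟨h1, h4⟩, rfl⟩
    rcases h4.lt_or_eq with h | rfl
    · exact coe_notMem_limitSet z₀ ⟨h1, h⟩
    · exact four_mem_discontinuitySet z₀
  have hint : interior fundamentalInterval ⊆ (↑) '' Set.Ioo (1 : ℝ) 4 := by
    rw [fundamentalInterval_eq]
    intro x hx
    obtain ⟨t, ht, rfl⟩ := interior_subset hx
    refine ⟨t, ?_, rfl⟩
    rw [← interior_Icc]
    refine interior_maximal ?_ (isOpen_interior.preimage (continuous_coe (X := ℝ))) hx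
    intro s hs
    obtain ⟨r, hr, hrs⟩ := interior_subset hs
    rwa [← coe_injective hrs]
  refine ⟨?_, ?_, ?_⟩
  · have hclosed : IsClosed fundamentalInterval := by
      rw [fundamentalInterval_eq]
      exact (isCompact_Icc.image continuous_coe).isClosed
    refine Set.Subset.antisymm
      (Set.inter_subset_left.trans (closure_minimal interior_subset hclosed))
      (Set.subset_inter ?_ hsub)
    have hIoo : (↑) '' Set.Ioo (1 : ℝ) 4 ⊆ interior fundamentalInterval := by
      refine interior_maximal ?_ (isOpen_image_coe.2 isOpen_Ioo)
      rw [fundamentalInterval_eq]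
      exact Set.image_mono Set.Ioo_subset_Icc_self
    refine Set.Subset.trans ?_ (closure_mono hIoo)
    rw [fundamentalInterval_eq, ← closure_Ioo (by norm_num : (1 : ℝ) ≠ 4)]
    exact image_closure_subset_closure_image continuous_coe
  · ext x
    rw [Set.mem_iUnion]
    constructor
    · rintro ⟨g, y, hy, rfl⟩
      exact fun h => hsub hy ((smul_mem_limitSet_iff g.2).1 h)
    · intro hx
      obtain ⟨g, hg, t, ht, h⟩ := mem_discontinuitySet_iff.1 hx
      refine ⟨(⟨g, hg⟩ : Γ)⁻¹, Set.mem_inv_smul_set_iff.2 ?_⟩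
      rw [fundamentalInterval_eq]
      exact ⟨t, ⟨ht.1, ht.2.le⟩, h.symm⟩
  · intro g hg
    rw [Set.disjoint_left]
    rintro x hx ⟨y, hy, hyx⟩
    obtain ⟨t, ht, rfl⟩ := hint hx
    obtain ⟨s, hs, rfl⟩ := hint hy
    exact hg (Subtype.ext (eq_one_of_smul_coe_eq_coe g.2 ⟨hs.1.le, hs.2⟩ ⟨ht.1.le, ht.2⟩ hyx))

/-- The saturation of an open set is the trace on `S` of the union of its translates, which are open
in `X` because `S` is. -/
theorem isOpenQuotientMap_orbitQuotient_mk {G X : Type*} [Group G] [MulAction G X]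
    [TopologicalSpace X] [ContinuousConstSMul G X] {S : Set X} (hS : IsOpen S) :
    IsOpenQuotientMap (Quotient.mk _ : S → orbitQuotient G S) where
  surjective := Quotient.mk_surjective
  continuous := continuous_quotient_mk'
  isOpenMap U hU := by
    rw [← isQuotientMap_quotient_mk'.isOpen_preimage]
    have h : (Quotient.mk _ : S → orbitQuotient G S) ⁻¹' (Quotient.mk _ '' U) =
        (↑) ⁻¹' ⋃ g : G, g • ((↑) '' U : Set X) := by
      ext x
      simp only [Set.mem_preimage, Set.mem_image, Set.mem_iUnion, Quotient.eq]
      constructor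
      · rintro ⟨y, hy, g, hg⟩
        exact ⟨g⁻¹, Set.mem_inv_smul_set_iff.2 ⟨y, hy, hg.symm⟩⟩
      · rintro ⟨g, hg⟩
        obtain ⟨_, ⟨y, hy, rfl⟩, hyx⟩ := hg
        exact ⟨y, hy, g⁻¹, by rw [← hyx]; exact inv_smul_smul g (y : X)⟩
    change IsOpen ((Quotient.mk _ : S → orbitQuotient G S) ⁻¹' (Quotient.mk _ '' U))
    rw [h]
    exact (isOpen_iUnion fun g => (hS.isOpenMap_subtype_val U hU).smul g).preimage
      continuous_subtype_val

/-- Spaces that are quotients of `X` by the same equivalence relation are homeomorphic. -/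
theorem nonempty_homeomorph_of_isQuotientMap {X Y Z : Type*} [TopologicalSpace X]
    [TopologicalSpace Y] [TopologicalSpace Z] {f : X → Y} {g : X → Z} (hf : IsQuotientMap f)
    (hg : IsQuotientMap g) (h : ∀ x x', f x = f x' ↔ g x = g x') : Nonempty (Y ≃ₜ Z) :=
  ⟨(IsQuotientMap.homeomorph (f := ⟨f, hf.continuous⟩) hf).symm.trans <|
    (Homeomorph.Quotient.congrRight (r := Setoid.ker f) (r' := Setoid.ker g) h).trans <|
    IsQuotientMap.homeomorph (f := ⟨g, hg.continuous⟩) hg⟩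

/-! ### The axis interval and the quotient circle. -/

/-- A parametrization of the axis interval `(3 - √5, 3 + √5)` of `AB⁻¹`. -/
noncomputable def axisParam (s : ℝ) : ℝ :=
  (3 - √5 + (3 + √5) * Real.exp s) / (1 + Real.exp s)

/-- The translation length of `AB⁻¹` in the parameter of `axisParam`. -/
noncomputable def axisPeriod : ℝ := 2 * Real.log ((7 + 3 * √5) / 2)

theorem sqrt_five_sq : √5 ^ 2 = 5 := Real.sq_sqrt (by norm_num)

theorem two_lt_sqrt_five : 2 < √5 := by
  rw [Real.lt_sqrt (by norm_num)]; norm_num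

theorem sqrt_five_lt : √5 < 7 / 3 := by
  rw [Real.sqrt_lt' (by norm_num)]; norm_num

theorem axisPeriod_pos : 0 < axisPeriod :=
  mul_pos two_pos (Real.log_pos (by linarith [two_lt_sqrt_five]))

theorem exp_axisPeriod : Real.exp axisPeriod = ((7 + 3 * √5) / 2) ^ 2 := by
  rw [axisPeriod, ← Nat.cast_two, ← Real.log_pow, Real.exp_log]
  have := two_lt_sqrt_five
  positivity

/-- Here `exp s = (t - (3 - √5)) / (3 + √5 - t)` is a coordinate sending the fixed points to `0` and
`∞`. In it the map is multiplication by the ratio of the eigenvalues `(-7 ± 3√5) / 2`, which equals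
`((7 + 3√5) / 2) ^ 2`. -/
theorem A_mul_B_inv_smul_axisParam (s : ℝ) :
    ((A * B⁻¹ : SL(2, ℝ)) : PSL(2, ℝ)) • (axisParam s : OnePoint ℝ) =
      axisParam (s + axisPeriod) := by
  have h5 := sqrt_five_sq
  have hl := sqrt_five_lt
  have hE := Real.exp_pos s
  rw [← ofHomogeneous_coe_one, smul_ofHomogeneous_of_coe_eq coe_A_mul_B_inv (by simp)]
  have h1 : axisParam (s + axisPeriod) = (3 - √5 + (3 + √5) * (Real.exp s * ((7 + 3 * √5) / 2) ^ 2)) /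
      (1 + Real.exp s * ((7 + 3 * √5) / 2) ^ 2) := by
    rw [axisParam, Real.exp_add, exp_axisPeriod]
  have hd1 : 0 < 1 + Real.exp s * ((7 + 3 * √5) / 2) ^ 2 := by positivity
  have hd2 : 1 + Real.exp s ≠ 0 := by positivity
  -- The factor `-((7 - 3√5) / 2)`, the eigenvalue at the fixed point `3 - √5`, is common to
  -- numerator and denominator and cancels.
  have hden : -3 / 2 * axisParam s + 1 * 1 =
      -((7 - 3 * √5) / 2) * (1 + Real.exp s * ((7 + 3 * √5) / 2) ^ 2) / (1 + Real.exp s) := by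
    rw [axisParam, eq_div_iff hd2, add_mul, mul_assoc, div_mul_cancel₀ _ hd2]
    linear_combination (-9 / 8 * Real.exp s * (7 + 3 * √5)) * h5
  have hnum : -8 * axisParam s + 6 * 1 =
      -((7 - 3 * √5) / 2) * (3 - √5 + (3 + √5) * (Real.exp s * ((7 + 3 * √5) / 2) ^ 2)) /
        (1 + Real.exp s) := by
    rw [axisParam, eq_div_iff hd2, add_mul, mul_assoc, div_mul_cancel₀ _ hd2]
    linear_combination (3 / 2 + 3 / 2 * Real.exp s -
      9 / 8 * Real.exp s * (21 + 16 * √5 + 3 * √5 ^ 2)) * h5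
  have hm : -((7 - 3 * √5) / 2) ≠ 0 := by linarith
  rw [hden, hnum, ofHomogeneous, if_neg (div_ne_zero (mul_ne_zero hm hd1.ne') hd2), h1]
  congr 1
  simp only
  rw [div_div_div_cancel_right₀ hd2, mul_div_mul_left _ _ hm]

theorem A_mul_B_inv_zpow_smul_axisParam (n : ℤ) (s : ℝ) :
    ((A * B⁻¹ : SL(2, ℝ)) : PSL(2, ℝ)) ^ n • (axisParam s : OnePoint ℝ) =
      axisParam (s + n * axisPeriod) := by
  induction n using Int.induction_on with
  | zero => simp
  | succ n ih =>
    rw [add_comm, zpow_add, mul_smul, ih, zpow_one, A_mul_B_inv_smul_axisParam]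
    push_cast
    ring_nf
  | pred n ih =>
    rw [sub_eq_neg_add, zpow_add, mul_smul, ih, zpow_neg_one, inv_smul_eq_iff,
      A_mul_B_inv_smul_axisParam]
    push_cast
    ring_nf

/-- The parameter of the point `1` of the axis interval. -/
noncomputable def axisStart : ℝ := 2 * Real.log (√5 - 2)

theorem exp_axisStart : Real.exp axisStart = (√5 - 2) ^ 2 := by
  rw [axisStart, ← Nat.cast_two, ← Real.log_pow, Real.exp_log]
  have := sub_pos.2 two_lt_sqrt_five
  push_cast
  positivity

theorem axisParam_mem_Ico {s : ℝ} :
    axisParam s ∈ Set.Ico (1 : ℝ) 4 ↔ s ∈ Set.Ico axisStart (axisStart + axisPeriod) := by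
  have h5 := sqrt_five_sq
  have hl := sqrt_five_lt
  have hg := two_lt_sqrt_five
  have hE := Real.exp_pos s
  -- This is the value of `exp s` at `t = 4`.
  have e2 : Real.exp (axisStart + axisPeriod) = ((1 + √5) / 2) ^ 2 := by
    rw [Real.exp_add, exp_axisStart, exp_axisPeriod, ← mul_pow]
    congr 1
    nlinarith
  rw [Set.mem_Ico, Set.mem_Ico, ← Real.exp_le_exp (x := axisStart),
    ← Real.exp_lt_exp (y := axisStart + axisPeriod), e2, exp_axisStart, axisParam,
    le_div_iff₀ (by positivity), div_lt_iff₀ (by positivity)]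
  generalize Real.exp s = E at *
  have k1 : (3 - √5 + (3 + √5) * E) - 1 * (1 + E) = (2 + √5) * (E - (√5 - 2) ^ 2) := by
    linear_combination (√5 - 2) * h5
  have k2 : 4 * (1 + E) - (3 - √5 + (3 + √5) * E) = (√5 - 1) * (((1 + √5) / 2) ^ 2 - E) := by
    linear_combination (-1 / 4 * (√5 + 1)) * h5
  constructor
  · rintro ⟨h1, h2⟩
    constructor
    · by_contra! h
      nlinarith
    · by_contra! h
      nlinarith
  · rintro ⟨h1, h2⟩
    constructor
    · nlinarith
    · nlinarith

theorem exists_axisParam_eq {t : ℝ} (ht : t ∈ Set.Ico (1 : ℝ) 4) : ∃ s, axisParam s = t := by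
  have hg := two_lt_sqrt_five
  have h1 : 0 < t - (3 - √5) := by linarith [ht.1]
  have h2 : 0 < 3 + √5 - t := by linarith [ht.2]
  refine ⟨Real.log ((t - (3 - √5)) / (3 + √5 - t)), ?_⟩
  rw [axisParam, Real.exp_log (div_pos h1 h2)]
  have : 1 + (t - (3 - √5)) / (3 + √5 - t) ≠ 0 := by positivity
  field_simp
  ring

theorem axisParam_injective : Function.Injective axisParam := by
  intro s t h
  have hg := two_lt_sqrt_five
  have hs := Real.exp_pos s
  have ht := Real.exp_pos t
  rw [axisParam, axisParam, div_eq_div_iff (by positivity) (by positivity)] at h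
  refine Real.exp_injective ?_
  have h' : 2 * √5 * (Real.exp s - Real.exp t) = 0 := by linear_combination h
  have := (mul_eq_zero.1 h').resolve_left (by positivity)
  linarith

theorem hasStrictDerivAt_axisParam (s : ℝ) :
    HasStrictDerivAt axisParam (2 * √5 * Real.exp s / (1 + Real.exp s) ^ 2) s := by
  have he := Real.hasStrictDerivAt_exp s
  have h := ((he.const_mul (3 + √5)).const_add (3 - √5)).div (he.const_add 1)
    (by positivity : 1 + Real.exp s ≠ 0)
  refine h.congr_deriv ?_
  ring

theorem isOpenMap_axisParam : IsOpenMap axisParam :=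
  isOpenMap_of_hasStrictDerivAt hasStrictDerivAt_axisParam fun s => by positivity

theorem continuous_axisParam : Continuous axisParam :=
  continuous_iff_continuousAt.2 fun s => (hasStrictDerivAt_axisParam s).hasDerivAt.continuousAt

theorem exists_zsmul_mem_Ico_axis (s : ℝ) :
    ∃ n : ℤ, axisParam (s + n * axisPeriod) ∈ Set.Ico (1 : ℝ) 4 := by
  obtain ⟨n, hn, -⟩ := existsUnique_add_zsmul_mem_Ico axisPeriod_pos s axisStart
  exact ⟨n, axisParam_mem_Ico.2 (by simpa using hn)⟩

theorem coe_axisParam_mem_discontinuitySet (z₀ : ℍ) (s : ℝ) :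
    (axisParam s : OnePoint ℝ) ∈ discontinuitySet Γ z₀ := by
  obtain ⟨n, hn⟩ := exists_zsmul_mem_Ico_axis s
  exact mem_discontinuitySet_iff.2 ⟨_, zpow_mem A_mul_B_inv_mem_Γ n, _, hn,
    A_mul_B_inv_zpow_smul_axisParam n s⟩

/-- Powers of `A * B⁻¹` carry both points into `[1, 4)`, where only the identity can relate them.
The connecting element is thus itself such a power. -/
theorem exists_smul_axisParam_eq_iff {s t : ℝ} :
    (∃ g ∈ Γ, g • (axisParam t : OnePoint ℝ) = axisParam s) ↔
      (s : AddCircle axisPeriod) = t := by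
  constructor
  · rintro ⟨g, hg, h⟩
    obtain ⟨n, hn⟩ := exists_zsmul_mem_Ico_axis s
    obtain ⟨m, hm⟩ := exists_zsmul_mem_Ico_axis t
    set a : PSL(2, ℝ) := ((A * B⁻¹ : SL(2, ℝ)) : PSL(2, ℝ)) with ha
    have haΓ : ∀ k : ℤ, a ^ k ∈ Γ := fun k => zpow_mem A_mul_B_inv_mem_Γ k
    have h1 : (a ^ n * g * (a ^ m)⁻¹) • (axisParam (t + m * axisPeriod) : OnePoint ℝ) =
        axisParam (s + n * axisPeriod) := by
      rw [← A_mul_B_inv_zpow_smul_axisParam, ← A_mul_B_inv_zpow_smul_axisParam, ← mul_smul,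
        inv_mul_cancel_right, mul_smul, h]
    have h2 := eq_one_of_smul_coe_eq_coe (mul_mem (mul_mem (haΓ n) hg) (inv_mem (haΓ m))) hm hn h1
    rw [h2, one_smul, OnePoint.coe_eq_coe] at h1
    have h3 := axisParam_injective h1
    refine QuotientAddGroup.eq.2 (AddSubgroup.mem_zmultiples_iff.2 ⟨n - m, ?_⟩)
    rw [zsmul_eq_mul]
    push_cast
    linear_combination -h3
  · intro h
    obtain ⟨n, hn⟩ := AddSubgroup.mem_zmultiples_iff.1 (QuotientAddGroup.eq.1 h.symm)
    refine ⟨_, zpow_mem A_mul_B_inv_mem_Γ n, ?_⟩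
    rw [A_mul_B_inv_zpow_smul_axisParam, ← zsmul_eq_mul, hn]
    simp

theorem nonempty_orbitQuotient_homeomorph_circle (z₀ : ℍ) :
    Nonempty (orbitQuotient Γ (discontinuitySet Γ z₀) ≃ₜ Circle) := by
  let Ω := discontinuitySet Γ z₀
  let τ : ℝ → Ω := fun s => ⟨axisParam s, coe_axisParam_mem_discontinuitySet z₀ s⟩
  have hτc : Continuous τ := (continuous_coe.comp continuous_axisParam).subtype_mk _
  have hτo : IsOpenMap τ := by
    intro U hU
    have h : τ '' U = (↑) ⁻¹' ((↑) '' (axisParam '' U) : Set (OnePoint ℝ)) := by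
      ext x
      constructor
      · rintro ⟨s, hs, rfl⟩
        exact ⟨_, ⟨s, hs, rfl⟩, rfl⟩
      · rintro ⟨_, ⟨s, hs, rfl⟩, h⟩
        exact ⟨s, hs, Subtype.ext h⟩
    rw [h]
    exact (isOpen_image_coe.2 (isOpenMap_axisParam U hU)).preimage continuous_subtype_val
  have hq := isOpenQuotientMap_orbitQuotient_mk (G := Γ) (isOpen_discontinuitySet Γ z₀)
  let φ : ℝ → orbitQuotient Γ Ω := fun s => Quotient.mk _ (τ s)
  -- Surjectivity holds because every orbit in `Ω` meets `[1, 4)`, which lies inside the axis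
  -- interval.
  have hφ : IsOpenQuotientMap φ := by
    refine ⟨?_, hq.continuous.comp hτc, hq.isOpenMap.comp hτo⟩
    intro y
    obtain ⟨x, rfl⟩ := hq.surjective y
    obtain ⟨g, hg, t, ht, h⟩ := mem_discontinuitySet_iff.1 x.2
    obtain ⟨s, rfl⟩ := exists_axisParam_eq ht
    exact ⟨s, Quotient.sound ⟨⟨g, hg⟩, h⟩⟩
  have hψ : IsOpenQuotientMap ((↑) : ℝ → AddCircle axisPeriod) :=
    QuotientAddGroup.isOpenQuotientMap_mk
  have hker : ∀ s t, φ s = φ t ↔ (s : AddCircle axisPeriod) = t := by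
    intro s t
    rw [← exists_smul_axisParam_eq_iff]
    change Quotient.mk _ _ = Quotient.mk _ _ ↔ _
    rw [Quotient.eq]
    exact ⟨fun ⟨g, hg⟩ => ⟨g, g.2, hg⟩, fun ⟨g, hg, h⟩ => ⟨⟨g, hg⟩, h⟩⟩
  obtain ⟨e⟩ := nonempty_homeomorph_of_isQuotientMap hφ.isQuotientMap hψ.isQuotientMap hker
  exact ⟨e.trans (AddCircle.homeomorphCircle axisPeriod_pos.ne')⟩

end DiscoGroup

theorem mainTheorem7 (z₀ : UpperHalfPlane) :
    Nonempty (DiscoGroup.orbitQuotient DiscoGroup.Γ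
      (DiscoGroup.discontinuitySet DiscoGroup.Γ z₀) ≃ₜ Circle) ∧
    DiscoGroup.IsFundamentalRegion DiscoGroup.Γ
      (DiscoGroup.discontinuitySet DiscoGroup.Γ z₀) DiscoGroup.fundamentalInterval ∧
    (DiscoGroup.A * DiscoGroup.B⁻¹).val.IsHyperbolic ∧
    ((DiscoGroup.A * DiscoGroup.B⁻¹ : SL(2, ℝ)) : PSL(2, ℝ)) •
      DiscoGroup.direction (Real.arctan 1) = DiscoGroup.direction (Real.arctan (1 / 4)) := by
  refine ⟨DiscoGroup.nonempty_orbitQuotient_homeomorph_circle z₀,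
    DiscoGroup.isFundamentalRegion_fundamentalInterval z₀, DiscoGroup.isHyperbolic_A_mul_B_inv, ?_⟩
  rw [DiscoGroup.direction_arctan one_ne_zero, DiscoGroup.direction_arctan (by norm_num), inv_one,
    DiscoGroup.A_mul_B_inv_smul_one]
  norm_num
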